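/- Let $G$ be a finite group, $p$ a prime dividing $|G|$, and $P$ a Sylow $p$-subgroup of $G$. Let $N$ be a normal subgroup of $G$ such that $G/N$ is $p$-supersoluble, i.e. every chief factor of $G/N$ has order $p$ or order prime to $p$. Let $d$ be the smallest number of generators of $P$ (so $p^d=|P/\Phi(P)|$, where $\Phi(P)$ is the Frattini subgroup of $P$). Write $\mathcal M_d(P)=\{P_1,\dots,P_d\}$ for a set of $d$ maximal subgroups of $P$ with $\bigcap_{i=1}^d P_i=\Phi(P)$; such a set is in general not unique. A subgroup $H$ of $G$ satisfies the $\Pi$-property in $G$ if, for every chief factor $L/K$ of $G$, every prime dividing $|G/K:N_{G/K}(HK/K\cap L/K)|$ divides $|HK/K\cap L/K|$. A group is $p$-nilpotent if it has a normal subgroup of order prime to $p$ whose index is a power of $p$. Then $G$ is $p$-nilpotent if and only if $N_G(P)$ is $p$-nilpotent and there is a choice of $\mathcal M_d(P)$ such that $P_i\cap N$ satisfies the $\Pi$-property in $G$ for every $P_i\in\mathcal M_d(P)$. Moreover, the same equivalence holds for each fixed choice of $\mathcal M_d(P)$: $G$ is $p$-nilpotent if and only if $N_G(P)$ is $p$-nilpotent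 and $P_i\cap N$ satisfies the $\Pi$-property in $G$ for every $P_i$ in that $\mathcal M_d(P)$. -/

import Mathlib

/-- `L / K` is a chief factor of `G`: the subgroups `K < L` are normal in `G` and no normal
subgroup of `G` lies strictly between them. -/
def IsChiefFactor {G : Type*} [Group G] (L K : Subgroup G) : Prop :=
  K.Normal ∧ L.Normal ∧ K < L ∧
    ∀ M : Subgroup G, M.Normal → K ≤ M → M ≤ L → M = K ∨ M = L

/-- For `K` normal in `G`, the subgroup `HK / K` of `G / K`; for `K ≤ H` this is `H / K`. -/
def imageMod {G : Type*} [Group G] (H K : Subgroup G) [K.Normal] : Subgroup (G ⧸ K) :=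
  H.map (QuotientGroup.mk' K)

/-- The set `π(n)` of the primes dividing `n`. -/
def primesOf (n : ℕ) : Set ℕ :=
  {q | q.Prime ∧ q ∣ n}

/-- A natural number is a `π`-number if all of its prime divisors belong to `π`. -/
def IsPiNumber (π : Set ℕ) (n : ℕ) : Prop :=
  ∀ q : ℕ, q.Prime → q ∣ n → q ∈ π

/-- `H` satisfies the `Π`-property in `G`: for every chief factor `L / K` of `G`, the index
`|G/K : N_{G/K}(HK/K ∩ L/K)|` is a `π(HK/K ∩ L/K)`-number. -/
def SatisfiesPiProperty {G : Type*} [Group G] (H : Subgroup G) : Prop :=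
  ∀ (L K : Subgroup G) [K.Normal], IsChiefFactor L K →
    IsPiNumber (primesOf (Nat.card ↥(imageMod H K ⊓ imageMod L K)))
      (Subgroup.normalizer
        ((imageMod H K ⊓ imageMod L K : Subgroup (G ⧸ K)) : Set (G ⧸ K))).index

/-- `G` is `p`-supersoluble: every chief factor of `G` has order `p` or order prime to `p`. -/
def IsPSupersoluble (p : ℕ) (G : Type*) [Group G] : Prop :=
  ∀ (L K : Subgroup G) [K.Normal], IsChiefFactor L K →
    Nat.card ↥(imageMod L K) = p ∨ ¬ p ∣ Nat.card ↥(imageMod L K)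

/-- `G` is `p`-nilpotent: `G` has a normal `p`-complement, that is, a normal subgroup of order
prime to `p` whose index is a power of `p`. -/
def IsPNilpotent (p : ℕ) (G : Type*) [Group G] : Prop :=
  ∃ N : Subgroup G, N.Normal ∧ ¬ p ∣ Nat.card ↥N ∧ ∃ k : ℕ, N.index = p ^ k

/-- `S` is a choice of `M_d(P)`: a set of exactly `d` maximal subgroups of `P` whose intersection
is the Frattini subgroup of `P`, where `d` is the smallest number of generators of `P`. -/
def IsMd (P : Type*) [Group P] [Group.FG P] (S : Set (Subgroup P)) : Prop :=
  (∀ M ∈ S, IsCoatom M) ∧ S.Finite ∧ S.ncard = Group.rank P ∧ sInf S = frattini P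

/-!
In a `p`-nilpotent group with complement `Q`, a chief factor `L / K` is either covered by `Q`, and
then it is a `p'`-group, or centralized by `Q`. In both cases the normalizer of the intersection of
`L / K` with the image of a `p`-subgroup has index a power of `p`, so every `p`-subgroup has the
`Π`-property (`IsPNilpotent.satisfiesPiProperty`). A set `M_d(P)` exists by Burnside's basis theorem
(`IsPGroup.exists_isMd`): take the kernels of the coordinate functionals of `P / Φ(P)`.

For the converse, the hypotheses are replaced by weaker ones that pass to quotients. A `p`-subgroup
normalized by `P` that has the `Π`-property covers or avoids every chief factor
(`SatisfiesPiProperty.coversOrAvoids`). From the `p`-nilpotency of `N_G(P)` only the inclusion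
`N_G(P) ≤ P C_G(P)` is kept; it implies that an element of `Z(P)` is not conjugate in `G` to another
element of `Z(P)`.

The core is the induction on `|G|` in `isPNilpotent_of_coversOrAvoids`. Let `V : G → P / P'` be the
transfer. If `N ⊓ ker V = 1`, then `N` is central, because `G / ker V` is abelian; `G / N` is
`p`-nilpotent because it is `p`-supersoluble and its minimal normal subgroups of order `p` are
central (`IsPSupersolubleAbove.isPNilpotent`), and Burnside's transfer theorem lifts this to `G`.
Otherwise there is a minimal normal subgroup `R` of `G` inside `N ⊓ ker V`, and each maximal
subgroup `M` of the given set contains `R` or meets it trivially.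
* If all of them contain `R`, then `R ≤ Φ(P)`. By induction `G / R` is `p`-nilpotent, and a Frattini
  argument with a complement of `R` in the preimage of the normal `p`-complement of `G / R` lifts
  this to `G` (`IsPNilpotent.of_quotient_of_nongenerating`).
* If some `M` meets `R` trivially, then `[P ⊓ R, P] ≤ M ⊓ R = 1`, so `P ⊓ R` is central in `P` and
  `V x = x ^ |G : P|` for `x ∈ P ⊓ R`. As `V x = 1` and `P' ≤ M`, this gives `P ⊓ R = 1`
  (`mem_commutator_of_transfer_eq_one`). So `R` is a `p'`-group, and the `p`-nilpotency of `G / R`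
  lifts to `G`.

Maximal subgroups enter the induction only through the inclusions `P' ≤ M` and the fact that their
intersection consists of nongenerators of `P`. The quotients by which one divides always satisfy
`P ⊓ R ≤ M` for all `M`, and so these properties are inherited (`nongenerating_map`).
-/

/-! ### Normal `p`-complements -/

theorem IsPNilpotent.exists_normal_of_quotient {p : ℕ} {G : Type*} [Group G] {R : Subgroup G}
    [R.Normal] (h : IsPNilpotent p (G ⧸ R)) :
    ∃ M : Subgroup G, M.Normal ∧ R ≤ M ∧ ¬ p ∣ R.relIndex M ∧ ∃ k : ℕ, M.index = p ^ k := by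
  obtain ⟨Q, hQ, hQp, k, hk⟩ := h
  have hs := QuotientGroup.mk'_surjective R
  refine ⟨Q.comap (QuotientGroup.mk' R), inferInstance, ?_, ?_, k, ?_⟩
  · simpa using Subgroup.ker_le_comap (QuotientGroup.mk' R) Q
  · have h1 := Subgroup.relIndex_comap (⊥ : Subgroup (G ⧸ R)) (QuotientGroup.mk' R)
      (Q.comap (QuotientGroup.mk' R))
    rw [MonoidHom.comap_bot, QuotientGroup.ker_mk', Subgroup.map_comap_eq_self_of_surjective hs,
      Subgroup.relIndex_bot_left] at h1
    rwa [h1]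
  · rw [Subgroup.index_comap_of_surjective _ hs, hk]

theorem IsPNilpotent.of_quotient_of_not_dvd_card {p : ℕ} [hp : Fact p.Prime] {G : Type*} [Group G]
    {R : Subgroup G} [R.Normal] (hR : ¬ p ∣ Nat.card R) (h : IsPNilpotent p (G ⧸ R)) :
    IsPNilpotent p G := by
  obtain ⟨M, hM, hRM, hp', hk⟩ := h.exists_normal_of_quotient
  refine ⟨M, hM, fun hd => ?_, hk⟩
  rw [← Subgroup.relIndex_bot_left M, ← Subgroup.relIndex_mul_relIndex ⊥ R M bot_le hRM,
    Subgroup.relIndex_bot_left] at hd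
  exact (hp.out.dvd_mul.mp hd).elim hR hp'

/-- The kernel, of order prime to `p`, consists of the `p'`-elements of `M`, hence it is normal in
`G` and not only in `M`. -/
theorem IsPNilpotent.of_hom {p : ℕ} [hp : Fact p.Prime] {G : Type*} [Group G] [Finite G]
    {M : Subgroup G} [M.Normal] (hM : ∃ k : ℕ, M.index = p ^ k) {A : Type*} [Group A]
    (hA : IsPGroup p A) (f : M →* A) (hf : ¬ p ∣ Nat.card f.ker) : IsPNilpotent p G := by
  obtain ⟨k, hk⟩ := hM
  have : Finite f.range := Set.finite_range f
  refine ⟨f.ker.map M.subtype, ⟨?_⟩, ?_, ?_⟩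
  · rintro _ ⟨x, hx, rfl⟩ g
    refine ⟨MulAut.conjNormal g x, ?_, by simp⟩
    have h1 : x ^ Nat.card f.ker = 1 := by
      have := pow_card_eq_one' (x := (⟨x, hx⟩ : f.ker))
      simpa [Subtype.ext_iff] using this
    have h2 : f (MulAut.conjNormal g x) ^ Nat.card f.ker = 1 := by
      rw [← map_pow, ← map_pow, h1, map_one, map_one]
    have h3 := hA.orderOf_coprime ((Nat.Prime.coprime_iff_not_dvd hp.out).mpr hf)
      (f (MulAut.conjNormal g x))
    exact orderOf_eq_one_iff.mp (Nat.Coprime.eq_one_of_dvd h3 (orderOf_dvd_of_pow_eq_one h2))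
  · rwa [Subgroup.card_map_of_injective M.subtype_injective]
  · obtain ⟨j, hj⟩ := (IsPGroup.iff_card (p := p) (G := f.range)).mp (hA.to_subgroup _)
    refine ⟨j + k, ?_⟩
    rw [Subgroup.index_map_subtype, Subgroup.index_ker, hj, hk, pow_add]

/-- The Sylow `p`-subgroups of the preimage of the complement of `G ⧸ R` are contained in `R`,
hence central, and the Burnside transfer theorem applies to that preimage. -/
theorem IsPNilpotent.of_quotient_of_le_center {p : ℕ} [hp : Fact p.Prime] {G : Type*} [Group G]
    [Finite G] {R : Subgroup G} [R.Normal] (hR : R ≤ Subgroup.center G)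
    (h : IsPNilpotent p (G ⧸ R)) : IsPNilpotent p G := by
  obtain ⟨M, hM, hRM, hp', hk⟩ := h.exists_normal_of_quotient
  obtain ⟨S⟩ : Nonempty (Sylow p M) := inferInstance
  have hSR : (S : Subgroup M) ≤ R.subgroupOf M := by
    intro x hx
    have hn : (x : M) ^ (R.subgroupOf M).index ∈ R.subgroupOf M :=
      Subgroup.pow_index_mem _ x
    have hco : (orderOf x).Coprime (R.subgroupOf M).index := by
      have := S.isPGroup'.orderOf_coprime ((Nat.Prime.coprime_iff_not_dvd hp.out).mpr hp') ⟨x, hx⟩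
      rwa [Subgroup.orderOf_mk] at this
    obtain ⟨m, hm⟩ := exists_pow_eq_self_of_coprime hco.symm
    rw [← hm]
    exact pow_mem hn m
  have hc : Subgroup.normalizer (S : Set M) ≤ Subgroup.centralizer (S : Set M) := by
    intro g _ x hx
    exact Subtype.ext ((Subgroup.mem_center_iff.mp (hR (hSR hx)) g).symm)
  exact .of_hom hk S.isPGroup' _ (MonoidHom.not_dvd_card_ker_transferSylow S hc)

theorem not_dvd_card_of_sylow_inf_eq_bot {p : ℕ} [hp : Fact p.Prime] {G : Type*} [Group G]
    [Finite G] (P : Sylow p G) {R : Subgroup G} [hR : R.Normal] (h : (P : Subgroup G) ⊓ R = ⊥) :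
    ¬ p ∣ Nat.card R := by
  intro hd
  obtain ⟨x, hx⟩ := exists_prime_orderOf_dvd_card' p hd
  have hx1 : orderOf (x : G) = p := by rw [Subgroup.orderOf_coe, hx]
  have hz : IsPGroup p (Subgroup.zpowers (x : G)) :=
    IsPGroup.of_card (n := 1) (by rw [Nat.card_zpowers, hx1, pow_one])
  obtain ⟨Q, hQ⟩ := hz.exists_le_sylow
  obtain ⟨g, rfl⟩ := MulAction.exists_smul_eq G P Q
  obtain ⟨y, hy, hyx⟩ := hQ (Subgroup.mem_zpowers (x : G))
  have hyx' : g * y * g⁻¹ = x := hyx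
  have hyR : y ∈ R := by
    have := hR.conj_mem _ x.2 g⁻¹
    rw [← hyx'] at this
    simpa [mul_assoc] using this
  have hy1 : y = 1 := by
    have : y ∈ (P : Subgroup G) ⊓ R := ⟨hy, hyR⟩
    rwa [h, Subgroup.mem_bot] at this
  rw [← hyx', hy1] at hx1
  simp at hx1
  exact hp.out.one_lt.ne hx1

/-! ### Lifting through a normal subgroup consisting of nongenerators -/

/-- Conjugacy of complements in the Schur–Zassenhaus theorem, for an abelian normal subgroup: a
complement `K` is the stabilizer of its own class in `H.QuotientDiff`, on which `H` acts
transitively. -/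
theorem Subgroup.IsComplement'.exists_conj_eq {G : Type*} [Group G] [Finite G]
    {H K K' : Subgroup G} [H.Normal] [IsMulCommutative H]
    (hH : (Nat.card H).Coprime H.index) (hK : Subgroup.IsComplement' H K)
    (hK' : Subgroup.IsComplement' H K') :
    ∃ h ∈ H, K' = K.map (MulAut.conj h).toMonoidHom := by
  have key : ∀ K : Subgroup G, Subgroup.IsComplement' H K →
      ∃ α : H.QuotientDiff, K = MulAction.stabilizer G α := by
    intro K hK
    refine ⟨Quotient.mk'' ⟨(K : Set G), hK.symm⟩, ?_⟩
    have hst := Subgroup.isComplement'_stabilizer_of_coprime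
      (α := (Quotient.mk'' ⟨(K : Set G), hK.symm⟩ : H.QuotientDiff)) hH
    refine Subgroup.eq_of_le_of_card_ge ?_ ?_
    · intro k hk
      refine congrArg Quotient.mk'' (Subtype.ext ?_)
      ext x
      constructor
      · rintro ⟨y, hy, rfl⟩
        exact K.mul_mem hy (K.inv_mem hk)
      · intro hx
        exact ⟨x * k, K.mul_mem hx hk, by simp⟩
    · have h1 := hst.card_mul_card
      rw [← hK.card_mul_card] at h1
      exact (Nat.eq_of_mul_eq_mul_left Nat.card_pos h1).le
  obtain ⟨α, rfl⟩ := key K hK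
  obtain ⟨β, rfl⟩ := key K' hK'
  obtain ⟨h, rfl⟩ := Subgroup.exists_smul_eq hH α β
  exact ⟨h, h.2, MulAction.stabilizer_smul_eq_stabilizer_map_conj (h : G) α⟩

/-- Frattini argument: if `M` is normal and `R` is an abelian normal Hall subgroup of `M`, then `R`
has a complement `Q` in `M` and `G` is generated by `R` and the normalizer of `Q`. -/
theorem exists_complement_sup_normalizer_eq_top {G : Type*} [Group G] [Finite G]
    {R M : Subgroup G} [hR : R.Normal] [M.Normal] [IsMulCommutative R] (hRM : R ≤ M)
    (hco : (Nat.card R).Coprime (R.relIndex M)) :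
    ∃ Q : Subgroup G, Q ≤ M ∧ Nat.card R * Nat.card Q = Nat.card M ∧
      R ⊔ Subgroup.normalizer (Q : Set G) = ⊤ := by
  have hcard : Nat.card (R.subgroupOf M) = Nat.card R :=
    Nat.card_congr (Subgroup.subgroupOfEquivOfLe hRM).toEquiv
  have hco' : (Nat.card (R.subgroupOf M)).Coprime (R.subgroupOf M).index := by rwa [hcard]
  have : IsMulCommutative (R.subgroupOf M) :=
    ⟨⟨fun a b => Subtype.ext (Subtype.ext (setLike_mul_comm (s := R) a.2 b.2))⟩⟩
  obtain ⟨Q, hQ⟩ := Subgroup.exists_right_complement'_of_coprime hco'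
  refine ⟨Q.map M.subtype, Subgroup.map_subtype_le Q, ?_, ?_⟩
  · rw [Subgroup.card_map_of_injective M.subtype_injective, ← hQ.card_mul_card, hcard]
  · rw [eq_top_iff]
    intro g _
    have hQc : Nat.card (Q.map (MulAut.conjNormal (H := M) g).toMonoidHom) = Nat.card Q :=
      Subgroup.card_map_of_injective (MulAut.conjNormal (H := M) g).injective
    have hQi : Nat.card Q = (R.subgroupOf M).index := by
      have := hQ.card_mul_card
      rw [← Subgroup.card_mul_index (R.subgroupOf M)] at this
      exact Nat.eq_of_mul_eq_mul_left Nat.card_pos this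
    have hQ' : Subgroup.IsComplement' (R.subgroupOf M)
        (Q.map (MulAut.conjNormal (H := M) g).toMonoidHom) :=
      Subgroup.isComplement'_of_coprime (by rw [hQc, hQ.card_mul_card]) (by rw [hQc, hQi]; exact hco')
    obtain ⟨r, hr, hrQ⟩ := hQ.exists_conj_eq hco' hQ'
    have hn : (r : G)⁻¹ * g ∈ Subgroup.normalizer (Q.map M.subtype : Set G) := by
      refine Subgroup.mem_normalizer_fintype ?_
      rintro _ ⟨x, hx, rfl⟩
      have h1 : MulAut.conjNormal g x ∈ Q.map (MulAut.conj r).toMonoidHom := by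
        rw [← hrQ]; exact ⟨x, hx, rfl⟩
      obtain ⟨y, hy, hyx⟩ := h1
      refine ⟨y, hy, ?_⟩
      have h2 := congrArg Subtype.val hyx
      simp at h2
      simp only [Subgroup.coe_subtype]
      have h3 : (y : G) = (r : G)⁻¹ * (g * x * g⁻¹) * r := by rw [← h2]; group
      rw [h3]; group
    have := Subgroup.mul_mem_sup (S := R) hr hn
    simpa using this

/-- An abelian normal subgroup `R` of `G` contained in a Sylow `p`-subgroup `P` and consisting of
nongenerators of `P` does not influence `p`-nilpotency. -/
theorem IsPNilpotent.of_quotient_of_nongenerating {p : ℕ} [hp : Fact p.Prime] {G : Type*}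
    [Group G] [Finite G] (P : Sylow p G) {R : Subgroup G} [hR : R.Normal] [IsMulCommutative R]
    (hRP : R ≤ P) (hgen : ∀ X ≤ (P : Subgroup G), (P : Subgroup G) ≤ X ⊔ R → (P : Subgroup G) ≤ X)
    (h : IsPNilpotent p (G ⧸ R)) : IsPNilpotent p G := by
  obtain ⟨M, hM, hRM, hp', k, hk⟩ := h.exists_normal_of_quotient
  obtain ⟨n, hn⟩ := (IsPGroup.iff_card (p := p) (G := R)).mp (P.isPGroup'.to_le hRP)
  have hco : (Nat.card R).Coprime (R.relIndex M) := by
    rw [hn]; exact Nat.Coprime.pow_left n ((Nat.Prime.coprime_iff_not_dvd hp.out).mpr hp')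
  obtain ⟨Q, hQM, hQc, hQ⟩ := exists_complement_sup_normalizer_eq_top hRM hco
  have hPn : (P : Subgroup G) ≤ Subgroup.normalizer (Q : Set G) := by
    refine le_trans (hgen (P ⊓ Subgroup.normalizer (Q : Set G)) inf_le_left ?_) inf_le_right
    intro x hx
    obtain ⟨r, hr, y, hy, rfl⟩ := Subgroup.mem_sup_of_normal_left.mp (hQ ▸ Subgroup.mem_top x)
    refine mul_mem (Subgroup.mem_sup_right hr) (Subgroup.mem_sup_left ⟨?_, hy⟩)
    have := (P : Subgroup G).mul_mem (inv_mem (hRP hr)) hx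
    rwa [inv_mul_cancel_left] at this
  have htop : Subgroup.normalizer (Q : Set G) = ⊤ :=
    top_le_iff.mp (hQ ▸ sup_le (hRP.trans hPn) le_rfl)
  have hrel : Nat.card Q = R.relIndex M := by
    rw [← Subgroup.relIndex_bot_left M, ← Subgroup.relIndex_mul_relIndex ⊥ R M bot_le hRM,
    Subgroup.relIndex_bot_left] at hQc
    exact Nat.eq_of_mul_eq_mul_left Nat.card_pos hQc
  refine ⟨Q, Subgroup.normalizer_eq_top_iff.mp htop, by rwa [hrel], n + k, ?_⟩
  have h1 := Subgroup.card_mul_index Q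
  rw [← Subgroup.card_mul_index M, ← hQc, hn, hk] at h1
  have h2 : Nat.card Q * Q.index = Nat.card Q * p ^ (n + k) := by rw [h1, pow_add]; ring
  exact Nat.eq_of_mul_eq_mul_left Nat.card_pos h2

/-! ### Chief factors and cover-avoidance -/

theorem IsChiefFactor.comap {G H : Type*} [Group G] [Group H] {f : G →* H}
    (hf : Function.Surjective f) {L K : Subgroup H} (h : IsChiefFactor L K) :
    IsChiefFactor (L.comap f) (K.comap f) := by
  obtain ⟨hK, hL, hlt, hM⟩ := h
  refine ⟨hK.comap f, hL.comap f, (Subgroup.comap_lt_comap_of_surjective hf).mpr hlt, ?_⟩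
  intro M hMn h1 h2
  have hker : f.ker ≤ M := (Subgroup.ker_le_comap f K).trans h1
  have hMM : (M.map f).comap f = M := Subgroup.comap_map_eq_self hker
  rw [← hMM, Subgroup.comap_le_comap_of_surjective hf] at h1 h2
  rcases hM (M.map f) (hMn.map f hf) h1 h2 with h | h
  · left; rw [← hMM, h]
  · right; rw [← hMM, h]

theorem IsChiefFactor.map {G H : Type*} [Group G] [Group H] {f : G →* H}
    (hf : Function.Surjective f) {L K : Subgroup G} (hK : f.ker ≤ K) (h : IsChiefFactor L K) :
    IsChiefFactor (L.map f) (K.map f) := by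
  obtain ⟨hKn, hL, hlt, hM⟩ := h
  have hKK : (K.map f).comap f = K := Subgroup.comap_map_eq_self hK
  have hLL : (L.map f).comap f = L := Subgroup.comap_map_eq_self (hK.trans hlt.le)
  refine ⟨hKn.map f hf, hL.map f hf, ?_, ?_⟩
  · rwa [← Subgroup.comap_lt_comap_of_surjective hf, hKK, hLL]
  · intro M hMn h1 h2
    rw [← Subgroup.comap_le_comap_of_surjective hf] at h1 h2
    rw [hKK] at h1
    rw [hLL] at h2
    rcases hM (M.comap f) (hMn.comap f) h1 h2 with h | h
    · left; rw [← h, Subgroup.map_comap_eq_self_of_surjective hf]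
    · right; rw [← h, Subgroup.map_comap_eq_self_of_surjective hf]

/-- Every nontrivial normal subgroup contains a minimal normal subgroup. -/
theorem exists_isChiefFactor_bot {G : Type*} [Group G] [Finite G] {T : Subgroup G} (hT : T.Normal)
    (hne : T ≠ ⊥) : ∃ R ≤ T, IsChiefFactor R ⊥ := by
  obtain ⟨R, hRT, hR⟩ := Finite.exists_le_minimal (p := fun U : Subgroup G => U.Normal ∧ U ≠ ⊥)
    ⟨hT, hne⟩
  refine ⟨R, hRT, inferInstance, hR.prop.1, bot_lt_iff_ne_bot.mpr hR.prop.2, fun M hM _ hMR => ?_⟩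
  by_cases h : M = ⊥
  · exact Or.inl h
  · exact Or.inr (le_antisymm hMR (hR.le_of_le ⟨hM, h⟩ hMR))

/-- Every chief factor `L / K` of `G` above `N` has order `p` or order prime to `p`; that is,
`G ⧸ N` is `p`-supersoluble, expressed inside `G`. -/
def IsPSupersolubleAbove (p : ℕ) {G : Type*} [Group G] (N : Subgroup G) : Prop :=
  ∀ L K : Subgroup G, IsChiefFactor L K → N ≤ K → K.relIndex L = p ∨ ¬ p ∣ K.relIndex L

/-- `T` covers or avoids each chief factor `L / K` of `G`. -/
def CoversOrAvoids {G : Type*} [Group G] (T : Subgroup G) : Prop :=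
  ∀ L K : Subgroup G, IsChiefFactor L K → T ⊓ L ≤ K ∨ L ≤ T ⊔ K

theorem card_imageMod {G : Type*} [Group G] (L K : Subgroup G) [K.Normal] :
    Nat.card (imageMod L K) = K.relIndex L := by
  rw [imageMod, ← Subgroup.relIndex_ker, QuotientGroup.ker_mk']

theorem IsPSupersolubleAbove.map {p : ℕ} {G H : Type*} [Group G] [Group H] {f : G →* H}
    (hf : Function.Surjective f) {N : Subgroup G} (h : IsPSupersolubleAbove p N) :
    IsPSupersolubleAbove p (N.map f) := by
  intro L K hLK hNK
  have := h _ _ (hLK.comap hf) (Subgroup.map_le_iff_le_comap.mp hNK)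
  rwa [Subgroup.relIndex_comap, Subgroup.map_comap_eq_self_of_surjective hf] at this

theorem IsPSupersoluble.above {p : ℕ} {G : Type*} [Group G] {N : Subgroup G} [N.Normal]
    (h : IsPSupersoluble p (G ⧸ N)) : IsPSupersolubleAbove p N := by
  intro L K hLK hNK
  have hs := QuotientGroup.mk'_surjective N
  have hker : (QuotientGroup.mk' N).ker ≤ K := by rwa [QuotientGroup.ker_mk']
  have hLK' := hLK.map hs hker
  have := hLK'.1
  have h1 := h _ _ hLK'
  rwa [card_imageMod, ← Subgroup.relIndex_comap, Subgroup.comap_map_eq_self hker] at h1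

theorem CoversOrAvoids.map {G H : Type*} [Group G] [Group H] {f : G →* H}
    (hf : Function.Surjective f) {T : Subgroup G} (h : CoversOrAvoids T) :
    CoversOrAvoids (T.map f) := by
  intro L K hLK
  refine (h _ _ (hLK.comap hf)).imp (fun h1 => ?_) (fun h1 => ?_)
  · rintro _ ⟨⟨x, hx, rfl⟩, hxL⟩
    exact h1 ⟨hx, hxL⟩
  · have := Subgroup.map_mono (f := f) h1
    rwa [Subgroup.map_sup, Subgroup.map_comap_eq_self_of_surjective hf,
      Subgroup.map_comap_eq_self_of_surjective hf] at this

/-- For a `p`-subgroup `T` normalized by a Sylow `p`-subgroup `P`, the normalizer of `TK/K ∩ L/K`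
has index a power of `p`, and prime to `p`, unless the intersection is trivial. Hence the
intersection is normal, and it is trivial or all of the chief factor. -/
theorem SatisfiesPiProperty.coversOrAvoids {p : ℕ} [hp : Fact p.Prime] {G : Type*} [Group G]
    [Finite G] (P : Sylow p G) {T : Subgroup G} (hT : IsPGroup p T)
    (hPT : (P : Subgroup G) ≤ Subgroup.normalizer (T : Set G)) (h : SatisfiesPiProperty T) :
    CoversOrAvoids T := by
  intro L K hLK
  have hK := hLK.1
  have hL := hLK.2.1
  have hs := QuotientGroup.mk'_surjective K
  have hpi := h L K hLK
  set X : Subgroup (G ⧸ K) := imageMod T K ⊓ imageMod L K with hX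
  have hXp : IsPGroup p X := (hT.map (QuotientGroup.mk' K)).to_inf_left
  have hLn : (imageMod L K).Normal := hL.map _ hs
  have hPX : ((P.mapSurjective hs : Sylow p (G ⧸ K)) : Subgroup (G ⧸ K)) ≤
      Subgroup.normalizer (X : Set (G ⧸ K)) := by
    rw [Sylow.coe_mapSurjective]
    rintro _ ⟨x, hx, rfl⟩
    refine Subgroup.mem_normalizer_fintype ?_
    rintro _ ⟨⟨t, ht, rfl⟩, htL⟩
    refine ⟨⟨x * t * x⁻¹, (Subgroup.mem_normalizer_iff.mp (hPT hx) t).mp ht, by simp⟩, ?_⟩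
    exact hLn.conj_mem _ htL _
  have hXn : X.Normal := by
    rw [← Subgroup.normalizer_eq_top_iff, ← Subgroup.index_eq_one]
    by_contra hne
    obtain ⟨q, hq, hqd⟩ := Nat.exists_prime_and_dvd hne
    obtain ⟨_, hqX⟩ := hpi q hq hqd
    obtain ⟨n, hn⟩ := (IsPGroup.iff_card (p := p) (G := X)).mp hXp
    rw [hn] at hqX
    obtain rfl := (Nat.prime_dvd_prime_iff_eq hq hp.out).mp (hq.dvd_of_dvd_pow hqX)
    exact (P.mapSurjective hs).not_dvd_index
      (hqd.trans (Subgroup.index_dvd_of_le hPX))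
  have hLc : (imageMod L K).comap (QuotientGroup.mk' K) = L :=
    Subgroup.comap_map_eq_self (by rw [QuotientGroup.ker_mk']; exact hLK.2.2.1.le)
  have hTc : (imageMod T K).comap (QuotientGroup.mk' K) = T ⊔ K := by
    rw [imageMod, Subgroup.comap_map_eq, QuotientGroup.ker_mk']
  have hXc : X.comap (QuotientGroup.mk' K) = (T ⊔ K) ⊓ L := by
    rw [hX, Subgroup.comap_inf, hLc, hTc]
  rcases hLK.2.2.2 (X.comap (QuotientGroup.mk' K)) (hXn.comap _)
    (by rw [hXc]; exact le_inf le_sup_right hLK.2.2.1.le) (by rw [hXc]; exact inf_le_right)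
    with h1 | h1
  · left
    rw [← h1, hXc]
    exact inf_le_inf_right _ le_sup_left
  · right
    rw [← h1, hXc]
    exact inf_le_left

/-! ### The normalizer of a Sylow subgroup -/

/-- The form in which the `p`-nilpotency of `N_G(P)` is used: unlike the latter, this condition
passes directly to the quotients of `G`. -/
theorem IsPNilpotent.normalizer_le {p : ℕ} [hp : Fact p.Prime] {G : Type*} [Group G] [Finite G]
    (P : Sylow p G) (h : IsPNilpotent p (Subgroup.normalizer (P : Set G))) :
    Subgroup.normalizer (P : Set G) ≤ (P : Subgroup G) ⊔ Subgroup.centralizer (P : Set G) := by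
  obtain ⟨Q, hQ, hQp, k, hk⟩ := h
  have hPN : (P : Subgroup G) ≤ Subgroup.normalizer (P : Set G) := Subgroup.le_normalizer
  let P' : Sylow p (Subgroup.normalizer (P : Set G)) := P.subtype hPN
  have hP' : (P' : Subgroup (Subgroup.normalizer (P : Set G))) = (P : Subgroup G).subgroupOf _ :=
    P.coe_subtype hPN
  have hPn : (P' : Subgroup (Subgroup.normalizer (P : Set G))).Normal := by
    rw [hP']; exact Subgroup.normal_in_normalizer
  have hdis : Disjoint Q (P' : Subgroup (Subgroup.normalizer (P : Set G))) := by
    obtain ⟨n, hn⟩ := (IsPGroup.iff_card (p := p) (G := P')).mp P'.isPGroup'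
    refine Subgroup.disjoint_of_coprime_natCard ?_
    rw [hn]
    exact ((Nat.Prime.coprime_iff_not_dvd hp.out).mpr hQp).symm.pow_right n
  have htop : Q ⊔ (P' : Subgroup (Subgroup.normalizer (P : Set G))) = ⊤ := by
    rw [← Subgroup.index_eq_one]
    obtain ⟨j, -, hj⟩ := (Nat.dvd_prime_pow hp.out).mp
      (hk ▸ Subgroup.index_dvd_of_le (le_sup_left (a := Q) (b := P'.toSubgroup)))
    have h2 : ¬ p ∣ (Q ⊔ P'.toSubgroup).index := fun hd =>
      P'.not_dvd_index (hd.trans (Subgroup.index_dvd_of_le le_sup_right))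
    rcases j with _ | j
    · simpa using hj
    · exact absurd (hj ▸ dvd_pow_self p (Nat.succ_ne_zero j)) h2
  intro x hx
  obtain ⟨q, hq, y, hy, hxy⟩ := Subgroup.mem_sup_of_normal_left.mp
    (htop ▸ Subgroup.mem_top (⟨x, hx⟩ : Subgroup.normalizer (P : Set G)))
  have hx' : x = q * y := (congrArg Subtype.val hxy).symm
  rw [hx']
  refine mul_mem (Subgroup.mem_sup_right fun z hz => ?_) (Subgroup.mem_sup_left ?_)
  · have hz' : (⟨z, hPN hz⟩ : Subgroup.normalizer (P : Set G)) ∈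
        (P' : Subgroup (Subgroup.normalizer (P : Set G))) := by rw [hP']; exact hz
    exact (congrArg Subtype.val (Subgroup.commute_of_normal_of_disjoint _ _ hQ hPn hdis _ _ hq hz')).symm
  · change y ∈ P'.toSubgroup at hy
    rw [hP'] at hy; exact hy

theorem Sylow.normalizer_mapSurjective_le {p : ℕ} [hp : Fact p.Prime] {G H : Type*} [Group G]
    [Finite G] [Group H] {f : G →* H} (hf : Function.Surjective f) (P : Sylow p G)
    (h : Subgroup.normalizer (P : Set G) ≤ (P : Subgroup G) ⊔ Subgroup.centralizer (P : Set G)) :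
    Subgroup.normalizer (P.mapSurjective hf : Set H) ≤
      (P.mapSurjective hf : Subgroup H) ⊔ Subgroup.centralizer (P.mapSurjective hf : Set H) := by
  intro y hy
  obtain ⟨g, rfl⟩ := hf y
  have hmem : ∀ x, x ∈ P.mapSurjective hf ↔ ∃ z ∈ P, f z = x := fun x => Iff.rfl
  set T : Subgroup G := (P : Subgroup G) ⊔ f.ker with hT
  have hPT : (P : Subgroup G) ≤ T := le_sup_left
  have hTf : T.map f = P.mapSurjective hf := by
    rw [hT, Subgroup.map_sup, (Subgroup.map_eq_bot_iff _).mpr le_rfl, sup_bot_eq,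
      Sylow.coe_mapSurjective]
  have hTc : T = (P.mapSurjective hf : Subgroup H).comap f := by
    rw [← hTf, Subgroup.comap_map_eq_self le_sup_right]
  have hgT : ((g • P : Sylow p G) : Subgroup G) ≤ T := by
    rintro _ ⟨x, hx, rfl⟩
    rw [hTc, Subgroup.mem_comap]
    have h1 := (Subgroup.mem_normalizer_iff.mp hy (f x)).mp ((hmem _).mpr ⟨x, hx, rfl⟩)
    simpa using h1
  obtain ⟨t, ht⟩ := MulAction.exists_smul_eq T ((g • P).subtype hgT) (P.subtype hPT)
  simp_rw [Sylow.smul_subtype, Subgroup.smul_def, smul_smul] at ht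
  have hn := h (Sylow.smul_eq_iff_mem_normalizer.mp (Sylow.subtype_injective ht))
  have hft : f t ∈ (P.mapSurjective hf : Subgroup H) := by
    rw [← hTf]; exact ⟨t, t.2, rfl⟩
  have hle : ((P : Subgroup G) ⊔ Subgroup.centralizer (P : Set G)).map f ≤
      (P.mapSurjective hf : Subgroup H) ⊔ Subgroup.centralizer (P.mapSurjective hf : Set H) := by
    rw [Subgroup.map_sup]
    refine sup_le_sup le_rfl ?_
    rintro _ ⟨x, hx, rfl⟩ _ ⟨z, hz, rfl⟩
    rw [← map_mul, hx z hz]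
    simp
  have h3 := hle ⟨_, hn, rfl⟩
  have h4 := mul_mem (inv_mem (Subgroup.mem_sup_left
    (T := Subgroup.centralizer (P.mapSurjective hf : Set H)) hft)) h3
  simpa using h4

/-- Elements of the centre of `P` are not fused with other elements of the centre. -/
theorem Sylow.conj_eq_self_of_mem_centralizer {p : ℕ} [hp : Fact p.Prime] {G : Type*} [Group G]
    [Finite G] (P : Sylow p G)
    (h : Subgroup.normalizer (P : Set G) ≤ (P : Subgroup G) ⊔ Subgroup.centralizer (P : Set G))
    {x g : G} (hxP : x ∈ P) (hx : x ∈ Subgroup.centralizer (P : Set G))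
    (hxg : g⁻¹ * x * g ∈ Subgroup.centralizer (P : Set G)) : g⁻¹ * x * g = x := by
  obtain ⟨n, hn, hxn⟩ := P.conj_eq_normalizer_conj_of_mem_centralizer x g hx hxg
  have hle : (P : Subgroup G) ⊔ Subgroup.centralizer (P : Set G) ≤
      Subgroup.centralizer ({x} : Set G) := by
    refine sup_le (fun y hy => ?_) (fun y hy => ?_)
    · rw [Subgroup.mem_centralizer_singleton_iff]
      exact hx y hy
    · rw [Subgroup.mem_centralizer_singleton_iff]
      exact (hy x hxP).symm
  have h1 := Subgroup.mem_centralizer_singleton_iff.mp (hle (h hn))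
  rw [hxn, mul_assoc, ← h1, inv_mul_cancel_left]

/-! ### `p`-supersoluble groups -/

/-- A normal subgroup of order `p` is central in `P`, so its elements have no other conjugates
when `N_G(P)` centralizes the centre of `P`. -/
theorem le_center_of_normal_of_card_eq {p : ℕ} [hp : Fact p.Prime] {G : Type*} [Group G] [Finite G]
    (P : Sylow p G)
    (h : Subgroup.normalizer (P : Set G) ≤ (P : Subgroup G) ⊔ Subgroup.centralizer (P : Set G))
    {R : Subgroup G} [hR : R.Normal] (hc : Nat.card R = p) : R ≤ Subgroup.center G := by
  have hRP : R ≤ P := IsPGroup.le_sylow_of_normal (IsPGroup.of_card (n := 1) (by simpa using hc)) P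
  have hRc : R ≤ Subgroup.centralizer (P : Set G) := by
    let _ : MulAction P R := MulAction.compHom R ((MulAut.conjNormal (H := R)).comp P.toSubgroup.subtype)
    obtain ⟨a, ha, ha1⟩ := P.isPGroup'.exists_fixed_point_of_prime_dvd_card_of_fixed_point
      R (by rw [hc]) (a := 1) (fun g => (MulAut.conjNormal (H := R) (g : G)).map_one)
    have hgen : Subgroup.zpowers a = ⊤ := by
      have : Fact (Nat.card R).Prime := ⟨hc ▸ hp.out⟩
      exact zpowers_eq_top_of_prime_card rfl (Ne.symm ha1)
    have haP : (a : G) ∈ Subgroup.centralizer (P : Set G) := by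
      intro g hg
      have h1 : MulAut.conjNormal (H := R) g a = a := ha ⟨g, hg⟩
      have h2 := congrArg Subtype.val h1
      rw [MulAut.conjNormal_apply] at h2
      exact mul_inv_eq_iff_eq_mul.mp h2
    intro x hx
    obtain ⟨n, hn⟩ := Subgroup.mem_zpowers_iff.mp (hgen ▸ Subgroup.mem_top (⟨x, hx⟩ : R))
    have : x = (a : G) ^ n := (congrArg Subtype.val hn).symm
    rw [this]
    exact zpow_mem haP n
  intro x hx
  rw [Subgroup.mem_center_iff]
  intro g
  have h1 := P.conj_eq_self_of_mem_centralizer h (g := g) (hRP hx) (hRc hx)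
    (hRc (by simpa using hR.conj_mem x hx g⁻¹))
  rw [mul_assoc, inv_mul_eq_iff_eq_mul] at h1
  exact h1.symm

theorem card_quotient_lt {G : Type*} [Group G] [Finite G] {R : Subgroup G} (hR : R ≠ ⊥) :
    Nat.card (G ⧸ R) < Nat.card G := by
  have h1 := Subgroup.card_mul_index R
  have h2 : 1 < Nat.card R := (Subgroup.one_lt_card_iff_ne_bot R).mpr hR
  have h3 : 0 < R.index := Nat.pos_of_ne_zero R.index_ne_zero_of_finite
  change R.index < _
  nlinarith

/-- A minimal normal subgroup of order `p` is central, because `N_G(P)` controls the fusion of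
central elements of `P`. -/
theorem IsPSupersolubleAbove.isPNilpotent {p : ℕ} [hp : Fact p.Prime] {G : Type*} [Group G]
    [Finite G] (P : Sylow p G)
    (h : Subgroup.normalizer (P : Set G) ≤ (P : Subgroup G) ⊔ Subgroup.centralizer (P : Set G))
    (hs : IsPSupersolubleAbove p (⊥ : Subgroup G)) : IsPNilpotent p G := by
  induction hn : Nat.card G using Nat.strong_induction_on generalizing G with
  | _ n ih =>
    by_cases htriv : (⊤ : Subgroup G) = ⊥
    · refine ⟨⊥, inferInstance, by simpa using hp.out.one_lt.ne', 0, ?_⟩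
      rw [← htriv]; simp
    obtain ⟨R, -, hR⟩ := exists_isChiefFactor_bot (T := (⊤ : Subgroup G)) inferInstance htriv
    have hRn := hR.2.1
    have hf := QuotientGroup.mk'_surjective R
    have hq : IsPNilpotent p (G ⧸ R) := by
      refine ih _ ?_ (P.mapSurjective hf) (P.normalizer_mapSurjective_le hf h) ?_ rfl
      · rw [← hn]; exact card_quotient_lt hR.2.2.1.ne'
      · have := hs.map hf
        rwa [Subgroup.map_bot] at this
    have h1 := hs R ⊥ hR le_rfl
    rw [Subgroup.relIndex_bot_left] at h1
    rcases h1 with h1 | h1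
    · exact .of_quotient_of_le_center (le_center_of_normal_of_card_eq P h h1) hq
    · exact .of_quotient_of_not_dvd_card h1 hq

/-! ### The transfer to the abelianization of a Sylow subgroup -/

/-- If `P ⊓ R` is central in `P`, then its elements are not fused, so the transfer `V` of `G` into
`P / P'` is given by `V x = x ^ |G : P|` on `P ⊓ R`, where the exponent is prime to `p`. -/
theorem mem_commutator_of_transfer_eq_one {p : ℕ} [hp : Fact p.Prime] {G : Type*} [Group G]
    [Finite G] (P : Sylow p G)
    (h : Subgroup.normalizer (P : Set G) ≤ (P : Subgroup G) ⊔ Subgroup.centralizer (P : Set G))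
    {R : Subgroup G} [hR : R.Normal]
    (hRP : (P : Subgroup G) ⊓ R ≤ Subgroup.centralizer (P : Set G)) {x : G} (hxP : x ∈ P)
    (hxR : x ∈ R)
    (hx : MonoidHom.transfer (Abelianization.of (G := (P : Subgroup G))) x = 1) :
    x ∈ ⁅(P : Subgroup G), (P : Subgroup G)⁆ := by
  have key : ∀ (k : ℕ) (g : G), g⁻¹ * x ^ k * g ∈ (P : Subgroup G) → g⁻¹ * x ^ k * g = x ^ k := by
    intro k g hg
    have hxk : x ^ k ∈ (P : Subgroup G) ⊓ R := pow_mem (⟨hxP, hxR⟩ : x ∈ (P : Subgroup G) ⊓ R) k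
    exact P.conj_eq_self_of_mem_centralizer h hxk.1 (hRP hxk)
      (hRP ⟨hg, by simpa using hR.conj_mem _ hxk.2 g⁻¹⟩)
  rw [MonoidHom.transfer_eq_pow _ x key] at hx
  have h1 : (⟨x ^ (P : Subgroup G).index, MonoidHom.transfer_eq_pow_aux x key⟩ : (P : Subgroup G)) ∈
      commutator (P : Subgroup G) := by
    rw [← Abelianization.ker_of]; exact hx
  have h2 : x ^ (P : Subgroup G).index ∈ ⁅(P : Subgroup G), (P : Subgroup G)⁆ := by
    have h3 := Subgroup.mem_map_of_mem (P : Subgroup G).subtype h1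
    rwa [commutator_def, Subgroup.map_commutator, ← MonoidHom.range_eq_map,
      Subgroup.range_subtype] at h3
  have hco : (orderOf x).Coprime (P : Subgroup G).index := by
    have := P.isPGroup'.orderOf_coprime ((Nat.Prime.coprime_iff_not_dvd hp.out).mpr P.not_dvd_index)
      ⟨x, hxP⟩
    rwa [Subgroup.orderOf_mk] at this
  obtain ⟨m, hm⟩ := exists_pow_eq_self_of_coprime hco.symm
  rw [← hm]
  exact pow_mem h2 m

/-! ### The criterion -/

/-- If the subgroups `M ∈ S` of `P` meet in a set of nongenerators of `P`, the same is true of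
their images modulo a normal subgroup whose intersection with `P` lies in all of them. -/
theorem nongenerating_map {G H : Type*} [Group G] [Group H] (f : G →* H) {P : Subgroup G}
    {S : Set (Subgroup G)} (hne : S.Nonempty) (hSP : ∀ M ∈ S, M ≤ P)
    (hgen : ∀ X ≤ P, P ≤ X ⊔ sInf S → P ≤ X) (hker : P ⊓ f.ker ≤ sInf S) :
    ∀ X ≤ P.map f, P.map f ≤ X ⊔ sInf (Subgroup.map f '' S) → P.map f ≤ X := by
  intro X hXP hX
  have hS : sInf (Subgroup.map f '' S) ≤ (sInf S).map f := by
    intro y hy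
    rw [Subgroup.mem_sInf] at hy
    obtain ⟨M₀, hM₀⟩ := hne
    obtain ⟨x, hx, rfl⟩ := hy _ ⟨M₀, hM₀, rfl⟩
    refine ⟨x, Subgroup.mem_sInf.mpr fun M hM => ?_, rfl⟩
    obtain ⟨m, hm, hmx⟩ := hy _ ⟨M, hM, rfl⟩
    have h1 : m⁻¹ * x ∈ P ⊓ f.ker :=
      Subgroup.mem_inf.mpr
      ⟨mul_mem (inv_mem (hSP M hM hm)) (hSP M₀ hM₀ hx), by simp [MonoidHom.mem_ker, hmx]⟩
    simpa using mul_mem hm (Subgroup.mem_sInf.mp (hker h1) M hM)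
  have hSP' : sInf S ≤ P := by
    obtain ⟨M₀, hM₀⟩ := hne
    exact (sInf_le hM₀).trans (hSP M₀ hM₀)
  have hXc : X = (X.comap f ⊓ P).map f := by
    refine le_antisymm (fun y hy => ?_) (Subgroup.map_le_iff_le_comap.mpr inf_le_left)
    obtain ⟨x, hx, rfl⟩ := hXP hy
    exact ⟨x, ⟨hy, hx⟩, rfl⟩
  have hP : P ≤ X.comap f ⊓ P := by
    refine hgen _ inf_le_right fun x hx => ?_
    have h1 := (hX.trans (sup_le_sup_left hS X)) ⟨x, hx, rfl⟩
    rw [hXc, ← Subgroup.map_sup] at h1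
    obtain ⟨z, hz, hzx⟩ := h1
    have hzP : z ∈ P := sup_le inf_le_right hSP' hz
    have h2 : z⁻¹ * x ∈ P ⊓ f.ker := Subgroup.mem_inf.mpr
      ⟨mul_mem (inv_mem hzP) hx, by simp [MonoidHom.mem_ker, hzx]⟩
    simpa using mul_mem hz (Subgroup.mem_sup_right (hker h2))
  exact Subgroup.map_le_iff_le_comap.mpr (hP.trans inf_le_left)

theorem Subgroup.map_inf_eq_of_ker_le {G H : Type*} [Group G] [Group H] (f : G →* H)
    (M : Subgroup G) {N : Subgroup G} (h : f.ker ≤ N) : (M ⊓ N).map f = M.map f ⊓ N.map f := by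
  refine le_antisymm (Subgroup.map_inf_le M N f) ?_
  rintro _ ⟨⟨m, hm, rfl⟩, n, hn, hnm⟩
  have h1 : n⁻¹ * m ∈ N := h (by simp [MonoidHom.mem_ker, hnm])
  exact ⟨m, ⟨hm, by simpa using mul_mem hn h1⟩, rfl⟩

/-- A minimal normal `p`-subgroup is abelian. -/
theorem IsChiefFactor.isMulCommutative {p : ℕ} [hp : Fact p.Prime] {G : Type*} [Group G]
    [Finite G] {R : Subgroup G} (hR : IsChiefFactor R ⊥) (hRp : IsPGroup p R) :
    IsMulCommutative R := by
  have hRn := hR.2.1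
  have : Nontrivial R := (Subgroup.nontrivial_iff_ne_bot R).mpr hR.2.2.1.ne'
  have hZ : (Subgroup.center R).map R.subtype = R := by
    refine (hR.2.2.2 _ inferInstance bot_le (Subgroup.map_subtype_le _)).resolve_left fun h => ?_
    rw [Subgroup.map_eq_bot_iff_of_injective _ R.subtype_injective] at h
    exact hRp.bot_lt_center.ne' h
  refine ⟨⟨fun a b => ?_⟩⟩
  obtain ⟨z, hz, hzb⟩ := hZ.ge b.2
  obtain rfl : z = b := Subtype.ext hzb
  exact Subgroup.mem_center_iff.mp hz a

/-- The inductive form of the criterion: the members of `S`, thought of as maximal subgroups of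
`P`, only need to contain the derived subgroup of `P` and to meet in a set of nongenerators of
`P`. -/
theorem isPNilpotent_of_coversOrAvoids {p : ℕ} [hp : Fact p.Prime] {G : Type*} [Group G]
    [Finite G] (P : Sylow p G)
    (h : Subgroup.normalizer (P : Set G) ≤ (P : Subgroup G) ⊔ Subgroup.centralizer (P : Set G))
    (N : Subgroup G) [hN : N.Normal] (hs : IsPSupersolubleAbove p N)
    {S : Set (Subgroup G)} (hne : S.Nonempty) (hSP : ∀ M ∈ S, M ≤ P)
    (hcomm : ∀ M ∈ S, ⁅(P : Subgroup G), (P : Subgroup G)⁆ ≤ M)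
    (hgen : ∀ X ≤ (P : Subgroup G), (P : Subgroup G) ≤ X ⊔ sInf S → (P : Subgroup G) ≤ X)
    (hca : ∀ M ∈ S, CoversOrAvoids (M ⊓ N)) : IsPNilpotent p G := by
  induction hn : Nat.card G using Nat.strong_induction_on generalizing G with
  | _ n ih =>
    set V := MonoidHom.transfer (Abelianization.of (G := (P : Subgroup G))) with hV
    by_cases hNV : N ⊓ V.ker = ⊥
    · -- `G ⧸ V.ker` is abelian, so `[N, G]` is contained in `N ⊓ V.ker`.
      have hNc : N ≤ Subgroup.center G := by
        intro x hx
        rw [Subgroup.mem_center_iff]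
        intro g
        have h1 : x * g * x⁻¹ * g⁻¹ ∈ N ⊓ V.ker := by
          refine Subgroup.mem_inf.mpr ⟨?_, ?_⟩
          · have := mul_mem hx (hN.conj_mem _ (inv_mem hx) g)
            simpa [mul_assoc] using this
          · rw [MonoidHom.mem_ker, map_mul, map_mul, map_mul, map_inv, map_inv,
              mul_comm (V x) (V g)]
            simp
        rw [hNV, Subgroup.mem_bot, mul_inv_eq_one, mul_inv_eq_iff_eq_mul] at h1
        exact h1.symm
      have hf := QuotientGroup.mk'_surjective N
      refine .of_quotient_of_le_center hNc
        (IsPSupersolubleAbove.isPNilpotent (P.mapSurjective hf)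
          (P.normalizer_mapSurjective_le hf h) ?_)
      have := hs.map hf
      rwa [(Subgroup.map_eq_bot_iff _).mpr (by rw [QuotientGroup.ker_mk'])] at this
    · obtain ⟨R, hRNV, hR⟩ := exists_isChiefFactor_bot inferInstance hNV
      have hRn := hR.2.1
      have hRN : R ≤ N := hRNV.trans inf_le_left
      have hf := QuotientGroup.mk'_surjective R
      have hquot : (P : Subgroup G) ⊓ R ≤ sInf S → IsPNilpotent p (G ⧸ R) := by
        intro hPR
        have hker : (P : Subgroup G) ⊓ (QuotientGroup.mk' R).ker ≤ sInf S := by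
          rwa [QuotientGroup.ker_mk']
        refine ih _ ?_ (P.mapSurjective hf) (P.normalizer_mapSurjective_le hf h)
          (N.map (QuotientGroup.mk' R)) (hN := hN.map _ hf) (hs.map hf)
          (S := Subgroup.map (QuotientGroup.mk' R) '' S) (hne.image _) ?_ ?_
          (nongenerating_map _ hne hSP hgen hker) ?_ rfl
        · rw [← hn]; exact card_quotient_lt hR.2.2.1.ne'
        · rintro _ ⟨M, hM, rfl⟩
          exact Subgroup.map_mono (hSP M hM)
        · rintro _ ⟨M, hM, rfl⟩
          rw [Sylow.coe_mapSurjective, ← Subgroup.map_commutator]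
          exact Subgroup.map_mono (hcomm M hM)
        · rintro _ ⟨M, hM, rfl⟩
          rw [← Subgroup.map_inf_eq_of_ker_le _ M (by rwa [QuotientGroup.ker_mk'])]
          exact (hca M hM).map hf
      by_cases hall : ∀ M ∈ S, R ≤ M
      · have hRS : R ≤ sInf S := le_sInf hall
        have hRP : R ≤ P := by
          obtain ⟨M, hM⟩ := hne
          exact (hall M hM).trans (hSP M hM)
        have := hR.isMulCommutative (P.isPGroup'.to_le hRP)
        exact .of_quotient_of_nongenerating P hRP
          (fun X hX hPX => hgen X hX (hPX.trans (sup_le_sup_left hRS X)))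
          (hquot (inf_le_right.trans hRS))
      · push Not at hall
        obtain ⟨M, hM, hRM⟩ := hall
        have hMR : M ⊓ R = ⊥ := by
          rcases hca M hM R ⊥ hR with h1 | h1
          · exact le_bot_iff.mp (le_trans (le_inf (le_inf inf_le_left (inf_le_right.trans hRN))
              inf_le_right) h1)
          · rw [sup_bot_eq] at h1
            exact absurd (h1.trans inf_le_left) hRM
        -- `[P ⊓ R, P]` lies in `M ⊓ R`, so that `P ⊓ R` is central in `P`.
        have hcent : (P : Subgroup G) ⊓ R ≤ Subgroup.centralizer (P : Set G) := by
          intro x hx g hg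
          have h1 : g * x * g⁻¹ * x⁻¹ ∈ M ⊓ R :=
            Subgroup.mem_inf.mpr ⟨hcomm M hM (Subgroup.commutator_mem_commutator hg hx.1),
              mul_mem (hRn.conj_mem x hx.2 g) (inv_mem hx.2)⟩
          rw [hMR, Subgroup.mem_bot, mul_inv_eq_one, mul_inv_eq_iff_eq_mul] at h1
          exact h1
        have hPR : (P : Subgroup G) ⊓ R = ⊥ := by
          rw [eq_bot_iff]
          intro x hx
          rw [← hMR]
          exact ⟨hcomm M hM (mem_commutator_of_transfer_eq_one P h hcent hx.1 hx.2
            (hRNV hx.2).2), hx.2⟩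
        exact .of_quotient_of_not_dvd_card (not_dvd_card_of_sylow_inf_eq_bot P hPR)
          (hquot (hPR ▸ bot_le))

/-! ### Maximal subgroups of finite `p`-groups -/

theorem IsPGroup.normal_of_isCoatom {p : ℕ} [Fact p.Prime] {P : Type*} [Group P] [Finite P]
    (hP : IsPGroup p P) {M : Subgroup P} (hM : IsCoatom M) : M.Normal :=
  have := hP.isNilpotent
  Subgroup.NormalizerCondition.normal_of_coatom M
    (Group.normalizerCondition_of_isNilpotent (G := P)) hM

theorem IsPGroup.index_of_isCoatom {p : ℕ} [hp : Fact p.Prime] {P : Type*} [Group P] [Finite P]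
    (hP : IsPGroup p P) {M : Subgroup P} (hM : IsCoatom M) : M.index = p := by
  obtain ⟨n, hn⟩ := (IsPGroup.iff_card (p := p) (G := P)).mp hP
  obtain ⟨m, hm⟩ := (IsPGroup.iff_card (p := p) (G := M)).mp (hP.to_subgroup M)
  obtain ⟨k, hk⟩ := hP.index M
  have hmul := Subgroup.card_mul_index M
  have hk0 : k ≠ 0 := by
    rintro rfl
    exact hM.1 (Subgroup.index_eq_one.mp (by simpa using hk))
  obtain ⟨j, rfl⟩ := Nat.exists_eq_succ_of_ne_zero hk0
  have hdvd : p ^ (m + 1) ∣ Nat.card P := by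
    rw [← hmul, hm, hk, ← pow_add]
    exact pow_dvd_pow p (by omega)
  obtain ⟨K, hK, hMK⟩ := Sylow.exists_subgroup_card_pow_succ hdvd hm
  have hlt : M < K := lt_of_le_of_ne hMK (by
    rintro rfl
    rw [hm] at hK
    exact absurd (Nat.pow_right_injective hp.out.two_le hK) (by omega))
  rw [hM.2 K hlt, Subgroup.card_top, ← hmul, hm, pow_succ] at hK
  exact Nat.eq_of_mul_eq_mul_left (pow_pos hp.out.pos m) hK

theorem IsPGroup.commutator_le_of_isCoatom {p : ℕ} [hp : Fact p.Prime] {P : Type*} [Group P]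
    [Finite P] (hP : IsPGroup p P) {M : Subgroup P} (hM : IsCoatom M) : commutator P ≤ M := by
  have := hP.normal_of_isCoatom hM
  have hcyc : IsCyclic (P ⧸ M) := isCyclic_of_prime_card (p := p) (hP.index_of_isCoatom hM)
  rw [← Subgroup.Normal.quotient_commutative_iff_commutator_le]
  infer_instance

theorem frattini_eq_sInf (P : Type*) [Group P] : frattini P = sInf {M : Subgroup P | IsCoatom M} :=
  sInf_eq_iInf.symm

theorem IsPGroup.commutator_le_frattini {p : ℕ} [hp : Fact p.Prime] {P : Type*} [Group P]
    [Finite P] (hP : IsPGroup p P) : commutator P ≤ frattini P := by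
  rw [frattini_eq_sInf]
  exact le_sInf fun M hM => hP.commutator_le_of_isCoatom hM

theorem IsPGroup.pow_mem_frattini {p : ℕ} [hp : Fact p.Prime] {P : Type*} [Group P] [Finite P]
    (hP : IsPGroup p P) (x : P) : x ^ p ∈ frattini P := by
  rw [frattini_eq_sInf, Subgroup.mem_sInf]
  intro M hM
  have := hP.normal_of_isCoatom hM
  have h := M.pow_index_mem x
  rwa [hP.index_of_isCoatom hM] at h

theorem Subgroup.isCoatom_of_index_eq_prime {p : ℕ} (hp : p.Prime) {P : Type*} [Group P]
    {M : Subgroup P} (hM : M.index = p) : IsCoatom M := by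
  refine ⟨fun h => ?_, fun K hK => ?_⟩
  · rw [h, Subgroup.index_top] at hM
    exact hp.one_lt.ne hM
  · have h1 := Subgroup.relIndex_mul_index hK.le
    rcases (Nat.dvd_prime hp).mp (hM ▸ Subgroup.index_dvd_of_le hK.le) with h | h
    · exact Subgroup.index_eq_one.mp h
    · rw [hM, h] at h1
      have h2 : M.relIndex K = 1 := by
        exact Nat.eq_of_mul_eq_mul_right hp.pos (by rw [h1, one_mul])
      exact absurd (Subgroup.relIndex_eq_one.mp h2) hK.not_ge

/-! ### Burnside's basis theorem -/

/-- The rank of `P` is the dimension of its Frattini quotient, which is presented here as a vector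
space `V` with a surjection `π` from `P`. -/
theorem rank_eq_finrank_of_ker_eq_frattini {p : ℕ} [hp : Fact p.Prime] {P : Type*} [Group P]
    [Finite P] {V : Type*} [AddCommGroup V] [Module (ZMod p) V] (π : P →* Multiplicative V)
    (hπ : Function.Surjective π) (hker : π.ker = frattini P) :
    Group.rank P = Module.finrank (ZMod p) V := by
  classical
  have hVfin : Finite V := Finite.of_surjective (fun x => (π x).toAdd) hπ
  -- `U W` is the preimage in `P` of the subspace `W` of `V`.
  let U : Submodule (ZMod p) V → Subgroup P := fun W =>
    (AddSubgroup.toSubgroup W.toAddSubgroup).comap π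
  have hU : ∀ W x, x ∈ U W ↔ (π x).toAdd ∈ W := fun _ _ => Iff.rfl
  have hspan : ∀ (T : Set P) (W : Submodule (ZMod p) V), Subgroup.closure T = ⊤ →
      (∀ x ∈ T, (π x).toAdd ∈ W) → W = ⊤ := by
    intro T W hT hTW
    rw [eq_top_iff]
    intro v _
    obtain ⟨x, hx⟩ := hπ (Multiplicative.ofAdd v)
    have h1 : x ∈ U W :=
      (Subgroup.closure_le (U W)).mpr (fun y hy => hTW y hy) (hT ▸ Subgroup.mem_top x)
    rw [hU, hx] at h1
    exact h1
  refine le_antisymm ?_ ?_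
  · let b := Module.finBasis (ZMod p) V
    choose x hx using fun i => hπ (Multiplicative.ofAdd (b i))
    have hgen : Subgroup.closure (Finset.univ.image x : Set P) = ⊤ := by
      refine frattini_nongenerating ?_
      rw [← hker, ← Subgroup.comap_map_eq, eq_top_iff]
      intro y _
      set K := (Subgroup.closure (Finset.univ.image x : Set P)).map π
      let W : Submodule (ZMod p) V := AddSubgroup.toZModSubmodule p (Subgroup.toAddSubgroup' K)
      have hW : W = ⊤ := by
        rw [eq_top_iff, ← b.span_eq, Submodule.span_le]
        rintro _ ⟨i, rfl⟩
        exact ⟨x i, Subgroup.subset_closure (by simp), hx i⟩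
      have h1 : (π y).toAdd ∈ W := hW ▸ Submodule.mem_top
      exact h1
    refine (Group.rank_le hgen).trans (Finset.card_image_le.trans ?_)
    simp
  · obtain ⟨T, hTc, hT⟩ := Group.rank_spec P
    have htop := hspan T (Submodule.span (ZMod p) (T.image fun x => (π x).toAdd : Finset V)) hT
      (fun x hx => Submodule.subset_span (by
        simp only [Finset.coe_image]; exact ⟨x, hx, rfl⟩))
    have h1 := finrank_span_finset_le_card (R := ZMod p) (T.image fun x => (π x).toAdd)
    rw [Set.finrank, htop, finrank_top] at h1
    exact h1.trans (Finset.card_image_le.trans hTc.le)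

/-- The kernels of the coordinate functionals of a basis of the Frattini quotient. -/
theorem exists_isMd_of_ker_eq_frattini {p : ℕ} [hp : Fact p.Prime] {P : Type*} [Group P]
    [Finite P] {V : Type*} [AddCommGroup V] [Module (ZMod p) V] (π : P →* Multiplicative V)
    (hπ : Function.Surjective π) (hker : π.ker = frattini P) :
    ∃ S : Set (Subgroup P), IsMd P S := by
  have hVfin : Finite V := Finite.of_surjective (fun x => (π x).toAdd) hπ
  let b := Module.finBasis (ZMod p) V
  let φ : Fin (Module.finrank (ZMod p) V) → P →* Multiplicative (ZMod p) := fun i =>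
    (AddMonoidHom.toMultiplicative (b.coord i).toAddMonoidHom).comp π
  have hφ : ∀ i x, x ∈ (φ i).ker ↔ b.repr (π x).toAdd i = 0 := fun _ _ => Iff.rfl
  choose x hx using fun i => hπ (Multiplicative.ofAdd (b i))
  have hxφ : ∀ i j, x i ∈ (φ j).ker ↔ i ≠ j := by
    intro i j
    rw [hφ, hx, toAdd_ofAdd, b.repr_self, Finsupp.single_apply]
    simp
  have hidx : ∀ i, (φ i).ker.index = p := by
    intro i
    have hdvd : (φ i).ker.index ∣ p := by
      rw [Subgroup.index_ker]
      simpa using Subgroup.card_subgroup_dvd_card (φ i).range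
    refine ((Nat.dvd_prime hp.out).mp hdvd).resolve_left fun h => ?_
    have h1 := (hxφ i i).mp (Subgroup.index_eq_one.mp h ▸ Subgroup.mem_top (x i))
    exact h1 rfl
  have hinj : Function.Injective fun i => (φ i).ker := by
    intro i j hij
    by_contra hne
    have h1 : x i ∈ (φ j).ker := (hxφ i j).mpr hne
    rw [← show (φ i).ker = (φ j).ker from hij] at h1
    exact (hxφ i i).mp h1 rfl
  refine ⟨Set.range fun i => (φ i).ker, ?_, Set.finite_range _, ?_, ?_⟩
  · rintro _ ⟨i, rfl⟩
    exact Subgroup.isCoatom_of_index_eq_prime hp.out (hidx i)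
  · rw [Set.ncard_range_of_injective hinj, Nat.card_fin,
      rank_eq_finrank_of_ker_eq_frattini (p := p) π hπ hker]
  · ext y
    rw [sInf_range, Subgroup.mem_iInf, ← hker, MonoidHom.mem_ker]
    constructor
    · intro h
      have h1 : b.repr (π y).toAdd = 0 := Finsupp.ext fun i => (hφ i y).mp (h i)
      exact (LinearEquiv.map_eq_zero_iff _).mp h1
    · intro h i
      rw [hφ, h]
      simp

theorem IsPGroup.exists_isMd {p : ℕ} [hp : Fact p.Prime] {P : Type*} [Group P] [Finite P]
    (hP : IsPGroup p P) : ∃ S : Set (Subgroup P), IsMd P S := by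
  have hcomm : IsMulCommutative (P ⧸ frattini P) :=
    Subgroup.Normal.quotient_commutative_iff_commutator_le.mpr hP.commutator_le_frattini
  let _ : CommGroup (P ⧸ frattini P) :=
    { (inferInstance : Group (P ⧸ frattini P)) with mul_comm := mul_comm' }
  let _ : Module (ZMod p) (Additive (P ⧸ frattini P)) := AddCommGroup.zmodModule (by
    intro x
    obtain ⟨y, hy⟩ := QuotientGroup.mk'_surjective (frattini P) x.toMul
    have h1 : x.toMul ^ p = 1 := by
      rw [← hy, ← map_pow]
      exact (QuotientGroup.eq_one_iff _).mpr (hP.pow_mem_frattini y)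
    exact h1)
  exact exists_isMd_of_ker_eq_frattini (p := p) (V := Additive (P ⧸ frattini P))
    (QuotientGroup.mk' (frattini P)) (QuotientGroup.mk'_surjective _) (QuotientGroup.ker_mk' _)

/-! ### `p`-nilpotent groups and the `Π`-property -/

theorem IsPNilpotent.subgroup {p : ℕ} [hp : Fact p.Prime] {G : Type*} [Group G] [Finite G]
    (h : IsPNilpotent p G) (H : Subgroup G) : IsPNilpotent p H := by
  obtain ⟨Q, hQ, hQp, k, hk⟩ := h
  refine ⟨Q.subgroupOf H, inferInstance, fun hd => hQp (hd.trans ?_), ?_⟩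
  · exact Subgroup.card_comap_dvd_of_injective Q H.subtype H.subtype_injective
  · obtain ⟨j, -, hj⟩ := (Nat.dvd_prime_pow hp.out).mp
      (hk ▸ Subgroup.relIndex_dvd_index_of_normal Q H)
    exact ⟨j, hj⟩

/-- In a `p`-nilpotent group the normal `p`-complement `Q` centralizes each chief factor that it
does not cover, and a chief factor covered by `Q` meets the image of a `p`-subgroup trivially. -/
theorem IsPNilpotent.satisfiesPiProperty {p : ℕ} [hp : Fact p.Prime] {G : Type*} [Group G]
    [Finite G] (h : IsPNilpotent p G) {T : Subgroup G} (hT : IsPGroup p T) :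
    SatisfiesPiProperty T := by
  intro L K hK hLK q hq hqd
  obtain ⟨Q, hQ, hQp, k, hk⟩ := h
  have hL := hLK.2.1
  set X : Subgroup (G ⧸ K) := imageMod T K ⊓ imageMod L K with hX
  have hXp : IsPGroup p X := (hT.map (QuotientGroup.mk' K)).to_inf_left
  by_cases hXbot : X = ⊥
  · rw [hXbot, (Subgroup.normalizer_eq_top_iff (H := (⊥ : Subgroup (G ⧸ K)))).mpr inferInstance,
      Subgroup.index_top] at hqd
    exact absurd (Nat.dvd_one.mp hqd) hq.one_lt.ne'
  have hpX : p ∣ Nat.card X :=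
    hXp.card_eq_or_dvd.resolve_left fun h1 => hXbot (Subgroup.card_eq_one.mp h1)
  have hQn : (Q.map (QuotientGroup.mk' K)) ≤ Subgroup.normalizer (X : Set (G ⧸ K)) := by
    rcases hLK.2.2.2 ((L ⊓ Q) ⊔ K) inferInstance le_sup_right
      (sup_le inf_le_left hLK.2.2.1.le) with h1 | h1
    · rintro _ ⟨g, hg, rfl⟩
      refine Subgroup.mem_normalizer_fintype ?_
      rintro x hx
      obtain ⟨l, hl, rfl⟩ := hx.2
      have h2 : g * l * g⁻¹ * l⁻¹ ∈ K := by
        refine (h1 ▸ le_sup_left : L ⊓ Q ≤ K) (Subgroup.mem_inf.mpr ⟨?_, ?_⟩)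
        · exact mul_mem (hL.conj_mem l hl g) (inv_mem hl)
        · have := mul_mem hg (hQ.conj_mem _ (inv_mem hg) l)
          simpa [mul_assoc] using this
      have h3 : QuotientGroup.mk' K (g * l * g⁻¹ * l⁻¹) = 1 := (QuotientGroup.eq_one_iff _).mpr h2
      rw [map_mul, map_mul, map_mul, map_inv, map_inv, mul_inv_eq_one] at h3
      rwa [h3]
    · exfalso
      refine hXbot ?_
      have hLQ : imageMod L K = (L ⊓ Q).map (QuotientGroup.mk' K) := by
        conv_lhs => rw [imageMod, ← h1, Subgroup.map_sup]
        rw [(Subgroup.map_eq_bot_iff (f := QuotientGroup.mk' K) K).mpr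
          (by rw [QuotientGroup.ker_mk']), sup_bot_eq]
      have hLp : ¬ p ∣ Nat.card (imageMod L K) := fun hd => hQp <| by
        rw [hLQ] at hd
        exact (hd.trans (Subgroup.card_map_dvd _ _)).trans (Subgroup.card_dvd_of_le inf_le_right)
      exact absurd (hpX.trans (Subgroup.card_dvd_of_le inf_le_right)) hLp
  have hqk : q ∣ p ^ k := by
    refine hqd.trans ((Subgroup.index_dvd_of_le hQn).trans ?_)
    rw [← hk]
    exact Subgroup.index_map_dvd Q (QuotientGroup.mk'_surjective K)
  obtain rfl := (Nat.prime_dvd_prime_iff_eq hq hp.out).mp (hq.dvd_of_dvd_pow hqk)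
  exact ⟨hq, hpX⟩

/-- The images in `G` of the members of `S` satisfy the hypotheses of
`isPNilpotent_of_coversOrAvoids`. -/
theorem isPNilpotent_of_isMd {p : ℕ} [hp : Fact p.Prime] {G : Type*} [Group G] [Finite G]
    (hpG : p ∣ Nat.card G) (P : Sylow p G) {N : Subgroup G} [hN : N.Normal]
    (hs : IsPSupersoluble p (G ⧸ N)) {S : Set (Subgroup (P : Subgroup G))}
    (hS : IsMd (P : Subgroup G) S) (hP : IsPNilpotent p (Subgroup.normalizer (P : Set G)))
    (hpi : ∀ M ∈ S, SatisfiesPiProperty (M.map (P : Subgroup G).subtype ⊓ N)) :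
    IsPNilpotent p G := by
  obtain ⟨hco, -, hcard, hinf⟩ := hS
  have hPp : IsPGroup p (P : Subgroup G) := P.isPGroup'
  have hne : S.Nonempty := by
    rw [Set.nonempty_iff_ne_empty]
    rintro rfl
    rw [Set.ncard_empty, eq_comm, Group.rank_eq_zero_iff] at hcard
    exact P.ne_bot_of_dvd_card hpG (Subgroup.eq_bot_of_subsingleton _)
  have hle : ∀ M : Subgroup (P : Subgroup G), M.map (P : Subgroup G).subtype ≤ P :=
    fun M => Subgroup.map_subtype_le M
  refine isPNilpotent_of_coversOrAvoids P (hP.normalizer_le P) N hs.above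
    (S := Subgroup.map (P : Subgroup G).subtype '' S) (hne.image _) ?_ ?_ ?_ ?_
  · rintro _ ⟨M, -, rfl⟩
    exact hle M
  · rintro _ ⟨M, hM, rfl⟩
    have h1 := Subgroup.map_mono (f := (P : Subgroup G).subtype)
      (hPp.commutator_le_of_isCoatom (hco M hM))
    rwa [commutator_def, Subgroup.map_commutator, ← MonoidHom.range_eq_map,
      Subgroup.range_subtype] at h1
  · intro X hXP hX
    have h1 : X.subgroupOf P = ⊤ := by
      refine frattini_nongenerating ?_
      rw [← hinf, eq_top_iff]
      intro x _
      have h2 : sInf (Subgroup.map (P : Subgroup G).subtype '' S) ≤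
          (sInf S).map (P : Subgroup G).subtype := by
        intro y hy
        rw [Subgroup.mem_sInf] at hy
        obtain ⟨M₀, hM₀⟩ := hne
        obtain ⟨z, -, rfl⟩ := hy _ ⟨M₀, hM₀, rfl⟩
        refine ⟨z, Subgroup.mem_sInf.mpr fun M hM => ?_, rfl⟩
        obtain ⟨m, hm, hmz⟩ := hy _ ⟨M, hM, rfl⟩
        obtain rfl : m = z := Subtype.ext hmz
        exact hm
      have h3 := (hX.trans (sup_le_sup_left h2 X)) x.2
      rw [← Subgroup.map_subgroupOf_eq_of_le hXP, ← Subgroup.map_sup] at h3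
      obtain ⟨z, hz, hzx⟩ := h3
      obtain rfl : z = x := Subtype.ext hzx
      exact hz
    exact Subgroup.subgroupOf_eq_top.mp h1
  · rintro _ ⟨M, hM, rfl⟩
    refine (hpi M hM).coversOrAvoids P (P.isPGroup'.to_le (inf_le_left.trans (hle M))) ?_
    have hMn := hPp.normal_of_isCoatom (hco M hM)
    intro g hg
    refine Subgroup.mem_normalizer_fintype ?_
    rintro _ ⟨⟨m, hm, rfl⟩, hmN⟩
    exact ⟨⟨_, hMn.conj_mem m hm ⟨g, hg⟩, rfl⟩, hN.conj_mem _ hmN g⟩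

/-! ### The equivalence -/

theorem theoremB (p : ℕ) (hp : p.Prime) (G : Type*) [Group G] [Finite G]
    (hpG : p ∣ Nat.card G) (P : Sylow p G) (N : Subgroup G) [N.Normal]
    (hN : IsPSupersoluble p (G ⧸ N)) :
    -- for some choice of `M_d(P)`
    (IsPNilpotent p G ↔
      IsPNilpotent p ↥(Subgroup.normalizer (P : Set G)) ∧
        ∃ S : Set (Subgroup ↥(P : Subgroup G)), IsMd ↥(P : Subgroup G) S ∧
          ∀ M ∈ S, SatisfiesPiProperty (M.map (P : Subgroup G).subtype ⊓ N)) ∧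
    -- for each fixed choice of `M_d(P)`
    (∀ S : Set (Subgroup ↥(P : Subgroup G)), IsMd ↥(P : Subgroup G) S →
      (IsPNilpotent p G ↔
        IsPNilpotent p ↥(Subgroup.normalizer (P : Set G)) ∧
          ∀ M ∈ S, SatisfiesPiProperty (M.map (P : Subgroup G).subtype ⊓ N))) := by
  have : Fact p.Prime := ⟨hp⟩
  have hpi : IsPNilpotent p G → ∀ M : Subgroup (P : Subgroup G),
      SatisfiesPiProperty (M.map (P : Subgroup G).subtype ⊓ N) := fun h M =>
    h.satisfiesPiProperty (P.isPGroup'.to_le (inf_le_left.trans (Subgroup.map_subtype_le M)))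
  refine ⟨⟨fun h => ⟨h.subgroup _, ?_⟩, ?_⟩, fun S hS => ⟨fun h => ⟨h.subgroup _, ?_⟩, ?_⟩⟩
  · obtain ⟨S, hS⟩ := IsPGroup.exists_isMd (P := (P : Subgroup G)) P.isPGroup'
    exact ⟨S, hS, fun M _ => hpi h M⟩
  · rintro ⟨hP, S, hS, h⟩
    exact isPNilpotent_of_isMd hpG P hN hS hP h
  · exact fun M _ => hpi h M
  · rintro ⟨hP, h⟩
    exact isPNilpotent_of_isMd hpG P hN hS hP h
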